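/- **Levi Schur–Weyl duality.** Let $n,r\ge 0$ be integers, let $\eta_1,\dots,\eta_{n+1}$ be the standard basis of $\mathbb{C}^{n+1}$, put $V=\mathbb{C}\eta_1\oplus\cdots\oplus\mathbb{C}\eta_n$ and $\eta=\eta_{n+1}$, so that $\mathbb{C}^{n+1}=V\oplus\mathbb{C}\eta$, and let $T=(\mathbb{C}^{n+1})^{\otimes r}$. Let $\Phi$ be the representation of $GL_{n+1}(\mathbb{C})$ on $T$ given by $\Phi(g)(v_1\otimes\cdots\otimes v_r)=gv_1\otimes\cdots\otimes gv_r$, and let $\Psi$ be the representation of the symmetric group $\mathfrak{S}_r$ on $T$ given by $\Psi(\sigma)(v_1\otimes\cdots\otimes v_r)=v_{\sigma^{-1}(1)}\otimes\cdots\otimes v_{\sigma^{-1}(r)}$. Regard $GL_n\times\mathbb{G}_m$ (with $GL_n=GL_n(\mathbb{C})$, $\mathbb{G}_m=\mathbb{C}^\times$) as a subgroup of $GL_{n+1}(\mathbb{C})$ via $(g,c)\mapsto\mathrm{diag}(g,c)$. Let $\mathbb{C}\Phi(GL_n\times\mathbb{G}_m)$ be the subalgebra of $\mathrm{End}_{\mathbb{C}}(T)$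 generated by all $\Phi(\mathrm{diag}(g,c))$, and let the Levi Schur algebra $\mathcal{L}(n,r)$ be the image of the group algebra $\mathbb{C}[GL_n\times\mathbb{G}_m]$ in $\mathrm{End}_{\mathbb{C}}(T)$ under the linear extension of $\Phi$. The degenerate double Hecke algebra $\mathcal{H}_r$ of $\mathfrak{S}_r$ is the associative unital $\mathbb{C}$-algebra with generators $\mathbf{s}_i$ ($1\le i\le r-1$) and $\mathbf{x}^{(l)}_\sigma$ ($0\le l\le r$, $\sigma\in\mathfrak{S}_l$) and relations, where $s_i=(i,i+1)$: * $\mathbf{s}_i^2=1$; $\ \mathbf{s}_i\mathbf{s}_j=\mathbf{s}_j\mathbf{s}_i$ if $|i-j|>1$; $\ \mathbf{s}_i\mathbf{s}_j\mathbf{s}_i=\mathbf{s}_j\mathbf{s}_i\mathbf{s}_j$ if $|i-j|=1$; * $\mathbf{x}^{(l)}_\sigma\mathbf{x}^{(l)}_\mu=\mathbf{x}^{(l)}_{\sigma\mu}$ for $\sigma,\mu\in\mathfrak{S}_l$; * $\mathbf{s}_i\mathbf{x}^{(l)}_\sigma=\mathbf{x}^{(l)}_{s_i\sigma}$ and $\mathbf{x}^{(l)}_\sigma\mathbf{s}_i=\mathbf{x}^{(l)}_{\sigma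 s_i}$ if $i<l$; * $\mathbf{s}_i\mathbf{x}^{(l)}_\sigma=\mathbf{x}^{(l)}_\sigma=\mathbf{x}^{(l)}_\sigma\mathbf{s}_i$ if $i>l$; * $\mathbf{x}^{(l)}_\delta\mathbf{x}^{(k)}_\gamma=0$ for $\delta\in\mathfrak{S}_l$, $\gamma\in\mathfrak{S}_k$, if $k\ne l$. It acts on $T$ by the representation $\Xi:\mathcal{H}_r\to\mathrm{End}_{\mathbb{C}}(T)$ determined by $\Xi(\mathbf{s}_i)=\Psi(s_i)$ and by the following rule. For a basis tensor $\eta_{j_1}\otimes\cdots\otimes\eta_{j_r}$, if $j_1,\dots,j_l\le n$ and $j_{l+1}=\cdots=j_r=n+1$, then $\Xi(\mathbf{x}^{(l)}_\sigma)$ sends it to $\eta_{j_{\sigma^{-1}(1)}}\otimes\cdots\otimes\eta_{j_{\sigma^{-1}(l)}}\otimes\eta^{\otimes(r-l)}$; otherwise $\Xi(\mathbf{x}^{(l)}_\sigma)$ sends it to $0$. Let $D(n,r)=\Xi(\mathcal{H}_r)$. For a subalgebra $A\subseteq\mathrm{End}_{\mathbb{C}}(T)$ let $\mathrm{End}_A(T)$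 be the algebra of all linear endomorphisms of $T$ commuting with every element of $A$. Then: 1. $\mathrm{End}_{D(n,r)}(T)=\mathbb{C}\Phi(GL_n\times\mathbb{G}_m)$; 2. $\mathrm{End}_{\mathcal{L}(n,r)}(T)=D(n,r)$ and $\mathrm{End}_{D(n,r)}(T)=\mathcal{L}(n,r)$. -/

import Mathlib

open scoped TensorProduct

noncomputable section

namespace LeviSW

/-! ### The enhanced tensor space -/

/-- The enhanced space `ℂ^{n+1} = V ⊕ ℂη`. Coordinates are indexed by `Fin (n+1)`; the first `n`
standard basis vectors span `V = ℂ^n`, and the last one is `η`. -/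
abbrev ESpace (n : ℕ) : Type := Fin (n + 1) → ℂ

/-- The tensor space `(ℂ^{n+1})^{⊗ r}`. -/
abbrev TSpace (n r : ℕ) : Type := ⨂[ℂ] _ : Fin r, ESpace n

/-- The algebra `End_ℂ((ℂ^{n+1})^{⊗ r})`. -/
abbrev TEnd (n r : ℕ) : Type := Module.End ℂ (TSpace n r)

/-- The projection of `V ⊕ ℂη` onto `ℂη` along `V`. -/
def projEta (n : ℕ) : ESpace n →ₗ[ℂ] ESpace n :=
  LinearMap.single ℂ (fun _ => ℂ) (Fin.last n) ∘ₗ LinearMap.proj (Fin.last n)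

/-- The projection of `V ⊕ ℂη` onto `V` along `ℂη`. -/
def projV (n : ℕ) : ESpace n →ₗ[ℂ] ESpace n := LinearMap.id - projEta n

/-- The tensor representation of `GL_{n+1}`:
`Φ(g)(v₁ ⊗ ⋯ ⊗ v_r) = g v₁ ⊗ ⋯ ⊗ g v_r`. -/
def Phi (n r : ℕ) : Representation ℂ (GL (Fin (n + 1)) ℂ) (TSpace n r) where
  toFun g := PiTensorProduct.map fun _ => Matrix.toLin' (g : Matrix (Fin (n + 1)) (Fin (n + 1)) ℂ)
  map_one' := by
    simp only [Units.val_one, Matrix.toLin'_one, PiTensorProduct.map_id]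
    rfl
  map_mul' g h := by
    simp only [Units.val_mul, Matrix.toLin'_mul, PiTensorProduct.map_comp]
    rfl

/-- The permutation representation of `S_r`:
`Ψ(σ)(v₁ ⊗ ⋯ ⊗ v_r) = v_{σ⁻¹(1)} ⊗ ⋯ ⊗ v_{σ⁻¹(r)}`. -/
def Psi (n r : ℕ) : Representation ℂ (Equiv.Perm (Fin r)) (TSpace n r) where
  toFun σ := (PiTensorProduct.reindex ℂ (fun _ => ESpace n) σ).toLinearMap
  map_one' := by
    refine PiTensorProduct.ext (MultilinearMap.ext fun v => ?_)
    exact PiTensorProduct.reindex_tprod (R := ℂ) (1 : Equiv.Perm (Fin r)) v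
  map_mul' σ τ := by
    refine PiTensorProduct.ext (MultilinearMap.ext fun v => ?_)
    simp only [LinearMap.compMultilinearMap_apply, Module.End.mul_apply, LinearEquiv.coe_coe]
    rw [PiTensorProduct.reindex_tprod, PiTensorProduct.reindex_tprod,
      PiTensorProduct.reindex_tprod]
    rfl

/-! ### The group `GL_n × G_m` and the Levi Schur algebra -/

/-- The block diagonal matrix `diag(A, c)` of size `n + 1`, as a monoid homomorphism. -/
def diagBlock (n : ℕ) :
    Matrix (Fin n) (Fin n) ℂ × ℂ →* Matrix (Fin (n + 1)) (Fin (n + 1)) ℂ where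
  toFun p := Matrix.reindex finSumFinEquiv finSumFinEquiv
    (Matrix.fromBlocks p.1 0 0 (Matrix.diagonal fun _ : Fin 1 => p.2))
  map_one' := by simp
  map_mul' p q := by
    simp [Matrix.fromBlocks_multiply, Matrix.submatrix_mul_equiv]

/-- The embedding `GL_n × G_m → GL_{n+1}`, `(g, c) ↦ diag(g, c)`. -/
def leviEmb (n : ℕ) : GL (Fin n) ℂ × ℂˣ →* GL (Fin (n + 1)) ℂ :=
  (Units.map (diagBlock n)).comp MulEquiv.prodUnits.symm.toMonoidHom

/-- The restriction of `Φ` to `GL_n × G_m`. -/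
def PhiLevi (n r : ℕ) : Representation ℂ (GL (Fin n) ℂ × ℂˣ) (TSpace n r) :=
  (Phi n r).comp (leviEmb n)

/-- `ℂΦ(GL_n × G_m)`: the subalgebra generated by the operators `Φ(diag(g, c))`. -/
def CPhiLevi (n r : ℕ) : Subalgebra ℂ (TEnd n r) :=
  Algebra.adjoin ℂ (Set.range (PhiLevi n r))

/-- The Levi Schur algebra `L(n,r)`: the image of (the group algebra of) `GL_n × G_m` under
`Φ`. -/
def leviSchur (n r : ℕ) : Subalgebra ℂ (TEnd n r) := (PhiLevi n r).asAlgebraHom.range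

/-! ### The degenerate double Hecke algebra -/

/-- The transposition of the adjacent (zero-based) positions `i`, `i + 1` in `S_m`. -/
def adjSwap (m i : ℕ) (h : i + 1 < m) : Equiv.Perm (Fin m) :=
  Equiv.swap ⟨i, by omega⟩ ⟨i + 1, h⟩

/-- Generators of the degenerate double Hecke algebra: `s_i` (one-based `1 ≤ i ≤ r - 1`; here `i`
is zero-based) and `x^{(l)}_σ` for `0 ≤ l ≤ r`, `σ ∈ S_l`. -/
inductive DDHAGen (r : ℕ) : Type
  | s (i : Fin (r - 1)) : DDHAGen r
  | x (l : Fin (r + 1)) (σ : Equiv.Perm (Fin l)) : DDHAGen r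

/-- The free generator `s_i`. -/
def fs {r : ℕ} (i : Fin (r - 1)) : FreeAlgebra ℂ (DDHAGen r) := FreeAlgebra.ι ℂ (DDHAGen.s i)

/-- The free generator `x^{(l)}_σ`. -/
def fx {r : ℕ} (l : Fin (r + 1)) (σ : Equiv.Perm (Fin l)) : FreeAlgebra ℂ (DDHAGen r) :=
  FreeAlgebra.ι ℂ (DDHAGen.x l σ)

/-- Defining relations of the degenerate double Hecke algebra. As `i` is zero-based, the
one-based conditions `i < l` and `i > l` read `i + 1 < l` and `l < i + 1`. -/
inductive DDHARel (r : ℕ) : FreeAlgebra ℂ (DDHAGen r) → FreeAlgebra ℂ (DDHAGen r) → Prop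
  | s_sq (i : Fin (r - 1)) : DDHARel r (fs i * fs i) 1
  | s_comm (i j : Fin (r - 1)) (h : (i : ℕ) + 1 < j ∨ (j : ℕ) + 1 < i) :
      DDHARel r (fs i * fs j) (fs j * fs i)
  | s_braid (i j : Fin (r - 1)) (h : (i : ℕ) + 1 = j ∨ (j : ℕ) + 1 = i) :
      DDHARel r (fs i * fs j * fs i) (fs j * fs i * fs j)
  | x_mul (l : Fin (r + 1)) (σ μ : Equiv.Perm (Fin l)) :
      DDHARel r (fx l σ * fx l μ) (fx l (σ * μ))
  | s_x (i : Fin (r - 1)) (l : Fin (r + 1)) (σ : Equiv.Perm (Fin l)) (h : (i : ℕ) + 1 < l) :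
      DDHARel r (fs i * fx l σ) (fx l (adjSwap l i h * σ))
  | x_s (i : Fin (r - 1)) (l : Fin (r + 1)) (σ : Equiv.Perm (Fin l)) (h : (i : ℕ) + 1 < l) :
      DDHARel r (fx l σ * fs i) (fx l (σ * adjSwap l i h))
  | s_x_absorb (i : Fin (r - 1)) (l : Fin (r + 1)) (σ : Equiv.Perm (Fin l))
      (h : (l : ℕ) < (i : ℕ) + 1) : DDHARel r (fs i * fx l σ) (fx l σ)
  | x_s_absorb (i : Fin (r - 1)) (l : Fin (r + 1)) (σ : Equiv.Perm (Fin l))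
      (h : (l : ℕ) < (i : ℕ) + 1) : DDHARel r (fx l σ * fs i) (fx l σ)
  | x_orth (l k : Fin (r + 1)) (δ : Equiv.Perm (Fin l)) (γ : Equiv.Perm (Fin k)) (h : l ≠ k) :
      DDHARel r (fx l δ * fx k γ) 0

/-- The degenerate double Hecke algebra `H_r` of `S_r`. -/
abbrev DDHA (r : ℕ) : Type := RingQuot (DDHARel r)

/-! ### The representation of the degenerate double Hecke algebra on the tensor space -/

/-- The inclusion `S_l ⊆ S_r` (`l ≤ r`), where `S_l` permutes the first `l` positions. -/
def permIncl {r : ℕ} (l : Fin (r + 1)) : Equiv.Perm (Fin l) →* Equiv.Perm (Fin r) :=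
  Equiv.Perm.viaEmbeddingHom (Fin.castLEEmb (Nat.lt_succ_iff.mp l.isLt))

/-- The projection of the tensor space onto `V^{⊗ l} ⊗ η^{⊗ (r-l)}`: a basis tensor is fixed if its
factors from `V` sit exactly in the first `l` positions, and is sent to zero otherwise. -/
def levelProj (n r : ℕ) (l : Fin (r + 1)) : TEnd n r :=
  PiTensorProduct.map fun i : Fin r => if (i : ℕ) < l then projV n else projEta n

/-- The operator by which `x^{(l)}_σ` acts: on `V^{⊗ l} ⊗ η^{⊗ (r-l)}` it permutes the first `l`
factors by `σ`; every basis tensor outside this subspace is sent to zero. -/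
def xOp (n r : ℕ) (l : Fin (r + 1)) (σ : Equiv.Perm (Fin l)) : TEnd n r :=
  Psi n r (permIncl l σ) * levelProj n r l

/-- The operators by which the generators act. -/
def genOp (n r : ℕ) : DDHAGen r → TEnd n r
  | .s i => Psi n r (adjSwap r i (by omega))
  | .x l σ => xOp n r l σ

theorem permIncl_apply_of_le {r : ℕ} (l : Fin (r + 1)) (σ : Equiv.Perm (Fin l)) (i : Fin r)
    (h : (l : ℕ) ≤ i) : permIncl l σ i = i := by
  apply Equiv.Perm.viaEmbedding_apply_of_notMem
  rintro ⟨j, hj⟩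
  have := congrArg Fin.val hj
  simp at this
  omega

theorem permIncl_apply_of_lt {r : ℕ} (l : Fin (r + 1)) (σ : Equiv.Perm (Fin l)) (i : Fin r)
    (h : (i : ℕ) < l) : ((permIncl l σ i : Fin r) : ℕ) = σ ⟨i, h⟩ := by
  have := Equiv.Perm.viaEmbedding_apply σ (Fin.castLEEmb (Nat.lt_succ_iff.mp l.isLt)) ⟨i, h⟩
  exact congrArg Fin.val this

theorem permIncl_lt_iff {r : ℕ} (l : Fin (r + 1)) (σ : Equiv.Perm (Fin l)) (i : Fin r) :
    ((permIncl l σ i : Fin r) : ℕ) < l ↔ (i : ℕ) < l := by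
  by_cases h : (i : ℕ) < l
  · simp [permIncl_apply_of_lt l σ i h, h]
  · rw [permIncl_apply_of_le l σ i (by omega)]

theorem adjSwap_val (m i : ℕ) (h : i + 1 < m) (j : Fin m) :
    ((adjSwap m i h j : Fin m) : ℕ) =
      if (j : ℕ) = i then i + 1 else if (j : ℕ) = i + 1 then i else j := by
  unfold adjSwap
  rw [Equiv.swap_apply_def]
  simp only [Fin.ext_iff]
  split_ifs <;> rfl

theorem adjSwap_comm (m i j : ℕ) (hi : i + 1 < m) (hj : j + 1 < m)
    (h : i + 1 < j ∨ j + 1 < i) :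
    adjSwap m i hi * adjSwap m j hj = adjSwap m j hj * adjSwap m i hi := by
  have h1 : adjSwap m i hi ⟨j, by omega⟩ = ⟨j, by omega⟩ := by
    apply Fin.ext
    rw [adjSwap_val]
    dsimp only
    split_ifs <;> omega
  have h2 : adjSwap m i hi ⟨j + 1, hj⟩ = ⟨j + 1, hj⟩ := by
    apply Fin.ext
    rw [adjSwap_val]
    dsimp only
    split_ifs <;> omega
  conv_lhs => rw [adjSwap.eq_def m j hj, Equiv.mul_swap_eq_swap_mul, h1, h2]
  rfl

theorem adjSwap_braid (m i j : ℕ) (hi : i + 1 < m) (hj : j + 1 < m) (h : i + 1 = j) :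
    adjSwap m i hi * adjSwap m j hj * adjSwap m i hi =
      adjSwap m j hj * adjSwap m i hi * adjSwap m j hj := by
  subst h
  have h1 : (adjSwap m i hi * adjSwap m (i + 1) hj) ⟨i, by omega⟩ = ⟨i + 1, hi⟩ := by
    apply Fin.ext
    simp [adjSwap_val]
    omega
  have h2 : (adjSwap m i hi * adjSwap m (i + 1) hj) ⟨i + 1, hi⟩ = ⟨i + 1 + 1, hj⟩ := by
    apply Fin.ext
    simp [adjSwap_val]
    omega
  conv_lhs =>
    rhs
    rw [adjSwap.eq_def m i hi]
  rw [Equiv.mul_swap_eq_swap_mul, h1, h2, ← mul_assoc]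
  rfl

theorem permIncl_adjSwap {r : ℕ} (l : Fin (r + 1)) (i : ℕ) (h : i + 1 < (l : ℕ))
    (h' : i + 1 < r) : permIncl l (adjSwap l i h) = adjSwap r i h' := by
  ext j
  by_cases hj : (j : ℕ) < l
  · rw [permIncl_apply_of_lt l _ j hj, adjSwap_val, adjSwap_val]
  · rw [permIncl_apply_of_le l _ j (by omega), adjSwap_val]
    split_ifs <;> omega

theorem projEta_projEta (n : ℕ) : projEta n ∘ₗ projEta n = projEta n := by
  ext i j
  simp [projEta]

theorem projV_projV (n : ℕ) : projV n ∘ₗ projV n = projV n := by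
  simp [projV, LinearMap.comp_sub, LinearMap.sub_comp, projEta_projEta]

theorem projV_projEta (n : ℕ) : projV n ∘ₗ projEta n = 0 := by
  simp [projV, LinearMap.sub_comp, projEta_projEta]

theorem projEta_projV (n : ℕ) : projEta n ∘ₗ projV n = 0 := by
  simp [projV, LinearMap.comp_sub, projEta_projEta]

theorem Psi_tprod (n r : ℕ) (σ : Equiv.Perm (Fin r)) (v : Fin r → ESpace n) :
    Psi n r σ (PiTensorProduct.tprod ℂ v) =
      PiTensorProduct.tprod ℂ fun i => v (σ.symm i) :=
  PiTensorProduct.reindex_tprod (R := ℂ) σ v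

theorem levelProj_tprod (n r : ℕ) (l : Fin (r + 1)) (v : Fin r → ESpace n) :
    levelProj n r l (PiTensorProduct.tprod ℂ v) =
      PiTensorProduct.tprod ℂ fun i : Fin r =>
        (if (i : ℕ) < l then projV n else projEta n) (v i) :=
  PiTensorProduct.map_tprod _ v

theorem levelProj_sq (n r : ℕ) (l : Fin (r + 1)) :
    levelProj n r l * levelProj n r l = levelProj n r l := by
  unfold levelProj
  rw [Module.End.mul_eq_comp, ← PiTensorProduct.map_comp]
  congr 1
  funext i
  split_ifs
  · exact projV_projV n
  · exact projEta_projEta n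

theorem levelProj_orth (n r : ℕ) (l k : Fin (r + 1)) (h : l ≠ k) :
    levelProj n r l * levelProj n r k = 0 := by
  have hlt : (l : ℕ) < k ∨ (k : ℕ) < l := by
    have := Fin.val_ne_of_ne h
    omega
  have hl := l.isLt
  have hk := k.isLt
  refine PiTensorProduct.ext (MultilinearMap.ext fun v => ?_)
  simp only [LinearMap.compMultilinearMap_apply, Module.End.mul_apply, levelProj_tprod,
    LinearMap.zero_apply]
  rcases hlt with hlt | hlt
  · apply MultilinearMap.map_coord_zero _ (⟨l, by omega⟩ : Fin r)
    simpa [hlt] using LinearMap.congr_fun (projEta_projV n) (v _)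
  · apply MultilinearMap.map_coord_zero _ (⟨k, by omega⟩ : Fin r)
    simpa [hlt] using LinearMap.congr_fun (projV_projEta n) (v _)

/-- A permutation that preserves the first `l` positions commutes with the projection. -/
theorem levelProj_comm (n r : ℕ) (l : Fin (r + 1)) (τ : Equiv.Perm (Fin r))
    (h : ∀ i, ((τ i : Fin r) : ℕ) < l ↔ (i : ℕ) < l) :
    levelProj n r l * Psi n r τ = Psi n r τ * levelProj n r l := by
  refine PiTensorProduct.ext (MultilinearMap.ext fun v => ?_)
  simp only [LinearMap.compMultilinearMap_apply, Module.End.mul_apply, levelProj_tprod,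
    Psi_tprod]
  congr 1
  funext i
  have := h (τ.symm i)
  rw [Equiv.apply_symm_apply] at this
  simp only [this]

/-- A permutation that fixes the first `l` positions is absorbed by the projection. -/
theorem Psi_levelProj (n r : ℕ) (l : Fin (r + 1)) (τ : Equiv.Perm (Fin r))
    (h : ∀ i : Fin r, (i : ℕ) < l → τ i = i) :
    Psi n r τ * levelProj n r l = levelProj n r l := by
  have hs : ∀ i : Fin r, (i : ℕ) < l → τ.symm i = i := fun i hi => by
    rw [Equiv.symm_apply_eq, h i hi]
  have hs' : ∀ i : Fin r, ¬ (i : ℕ) < l → ¬ ((τ.symm i : Fin r) : ℕ) < l := fun i hi hc => by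
    have := h _ hc
    rw [Equiv.apply_symm_apply] at this
    exact hi (this ▸ hc)
  refine PiTensorProduct.ext (MultilinearMap.ext fun v => ?_)
  simp only [LinearMap.compMultilinearMap_apply, Module.End.mul_apply, levelProj_tprod,
    Psi_tprod]
  let c : Fin r → ℂ := fun i => if (i : ℕ) < l then 1 else v i (Fin.last n)
  let u : Fin r → ESpace n := fun i =>
    if (i : ℕ) < l then projV n (v i) else Pi.single (Fin.last n) 1
  have hw : ∀ i : Fin r, (if (i : ℕ) < l then projV n else projEta n) (v i) = c i • u i := by
    intro i
    by_cases hi : (i : ℕ) < l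
    · simp [c, u, hi]
    · simp only [c, u, hi, if_false]
      funext j
      simp [projEta, Pi.single_apply]
  have hu : ∀ i, u (τ.symm i) = u i := by
    intro i
    by_cases hi : (i : ℕ) < l
    · rw [hs i hi]
    · simp [u, hi, hs' i hi]
  simp only [hw, hu]
  rw [MultilinearMap.map_smul_univ, MultilinearMap.map_smul_univ]
  congr 1
  exact Equiv.prod_comp τ.symm c

theorem genOp_rel (n r : ℕ) {a b : FreeAlgebra ℂ (DDHAGen r)} (h : DDHARel r a b) :
    FreeAlgebra.lift ℂ (genOp n r) a = FreeAlgebra.lift ℂ (genOp n r) b := by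
  cases h with
  | s_sq i =>
    simp only [fs, map_mul, FreeAlgebra.lift_ι_apply, genOp, map_one]
    rw [← map_mul, adjSwap, Equiv.swap_mul_self, map_one]
  | s_comm i j h =>
    simp only [fs, map_mul, FreeAlgebra.lift_ι_apply, genOp]
    rw [← map_mul, ← map_mul]
    rw [adjSwap_comm r i j _ _ h]
  | s_braid i j h =>
    simp only [fs, map_mul, FreeAlgebra.lift_ι_apply, genOp]
    rw [← map_mul, ← map_mul, ← map_mul, ← map_mul]
    rcases h with h | h
    · rw [adjSwap_braid r i j _ _ h]
    · rw [adjSwap_braid r j i _ _ h]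
  | x_mul l σ μ =>
    simp only [fx, map_mul, FreeAlgebra.lift_ι_apply, genOp, xOp]
    rw [mul_assoc, ← mul_assoc (levelProj n r l),
      levelProj_comm n r l _ (permIncl_lt_iff l μ), mul_assoc, levelProj_sq, ← mul_assoc]
  | s_x i l σ h =>
    simp only [fs, fx, map_mul, FreeAlgebra.lift_ι_apply, genOp, xOp]
    rw [permIncl_adjSwap l i h (by omega), ← mul_assoc]
  | x_s i l σ h =>
    simp only [fs, fx, map_mul, FreeAlgebra.lift_ι_apply, genOp, xOp]
    rw [← permIncl_adjSwap l i h (by omega), mul_assoc,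
      levelProj_comm n r l _ (permIncl_lt_iff l _), ← mul_assoc]
  | s_x_absorb i l σ h =>
    simp only [fs, fx, map_mul, FreeAlgebra.lift_ι_apply, genOp, xOp]
    have hfix : ∀ k : Fin r, (k : ℕ) < l → adjSwap r i (by omega) k = k := by
      intro k hk
      ext
      rw [adjSwap_val]
      split_ifs <;> omega
    have hc : adjSwap r i (by omega) * permIncl l σ =
        permIncl l σ * adjSwap r i (by omega) := by
      refine Equiv.ext fun k => ?_
      simp only [Equiv.Perm.mul_apply]
      by_cases hk : (k : ℕ) < l
      · rw [hfix k hk, hfix _ ((permIncl_lt_iff l σ k).mpr hk)]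
      · rw [permIncl_apply_of_le l σ k (by omega), permIncl_apply_of_le]
        rw [adjSwap_val]
        split_ifs <;> omega
    rw [← mul_assoc, ← map_mul, hc, map_mul, mul_assoc, Psi_levelProj n r l _ hfix]
  | x_s_absorb i l σ h =>
    simp only [fs, fx, map_mul, FreeAlgebra.lift_ι_apply, genOp, xOp]
    have hfix : ∀ k : Fin r, (k : ℕ) < l → adjSwap r i (by omega) k = k := by
      intro k hk
      ext
      rw [adjSwap_val]
      split_ifs <;> omega
    have hlt : ∀ k : Fin r, ((adjSwap r i (by omega) k : Fin r) : ℕ) < l ↔ (k : ℕ) < l := by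
      intro k
      rw [adjSwap_val]
      split_ifs <;> omega
    rw [mul_assoc, levelProj_comm n r l _ hlt, Psi_levelProj n r l _ hfix]
  | x_orth l k δ γ h =>
    simp only [fx, map_mul, FreeAlgebra.lift_ι_apply, genOp, xOp, map_zero]
    rw [← levelProj_comm n r k _ (permIncl_lt_iff k γ), mul_assoc,
      ← mul_assoc (levelProj n r l), levelProj_orth n r l k h, zero_mul, mul_zero]

/-- The representation `Ξ` of `H_r` on the tensor space: `s_i` acts by `Ψ(s_i)`, and `x^{(l)}_σ`
acts by `xOp n r l σ`. -/
def Xi (n r : ℕ) : DDHA r →ₐ[ℂ] TEnd n r :=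
  RingQuot.liftAlgHom ℂ ⟨FreeAlgebra.lift ℂ (genOp n r), fun _ _ h => genOp_rel n r h⟩

/-- The finite-dimensional degenerate double Hecke algebra `D(n,r) = Ξ(H_r)`. -/
def finDDHA (n r : ℕ) : Subalgebra ℂ (TEnd n r) := (Xi n r).range

/-- `End_A(T)` for a subalgebra `A ⊆ End_ℂ(T)`, `T` the tensor space: the subalgebra of all linear
endomorphisms of `T` that commute with every element of `A`. -/
def endOver {n r : ℕ} (A : Subalgebra ℂ (TEnd n r)) : Subalgebra ℂ (TEnd n r) :=
  Subalgebra.centralizer ℂ (A : Set (TEnd n r))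

end LeviSW

end

open scoped TensorProduct

noncomputable section


/-! Write `D` for `finDDHA n r`. The tensor space splits into summands indexed by sets `I` of
positions, those carrying a factor from `V`; `posProj n r I` is the projection onto the summand. For
commutants and stable subspaces, `D` can be replaced by the operators `Ψ(σ)` and the `posProj n r
I`: the latter are conjugates under `Ψ` of the operators of the `x^{(l)}_1`, and conversely every
`x^{(l)}_σ` acts as a product of the two kinds.

One operator carries the proof. `average` cuts an endomorphism down to its diagonal blocks for this
splitting, then averages over conjugation by the symmetric group. Its values commute with `D`, and
it fixes everything that commutes with `D`.

The commutant of `D` is `CPhiLevi n r`. One inclusion is a direct check. For the other it suffices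
that every average lies in `CPhiLevi n r`, and by linearity only pure tensors of endomorphisms
matter. The average of such a tensor is a symmetrized product of block diagonal maps; by
polarization it is a combination of powers `q ⊗ ⋯ ⊗ q` with `q` block diagonal. If `q` is singular,
`q + t` is invertible for all but finitely many scalars `t`, and a polynomial argument brings the
power of `q` into the span.

As in Maschke's theorem, averaging a linear projection onto a `D`-stable subspace gives a `D`-linear
one. The tensor space is thus semisimple over `D`, and Jacobson density shows that `D` is its own
double commutant. The remaining claims follow since `leviSchur n r` and `CPhiLevi n r` coincide. -/

/-! ### Double centralizers, polarization and generic points. -/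

/-- The double centralizer theorem for a subalgebra acting semisimply on a finite-dimensional
vector space. -/
theorem Subalgebra.centralizer_centralizer_of_isSemisimpleModule {K V : Type*} [Field K]
    [AddCommGroup V] [Module K V] [FiniteDimensional K V] (A : Subalgebra K (Module.End K V))
    [IsSemisimpleModule A V] :
    Subalgebra.centralizer K
      (Subalgebra.centralizer K (A : Set (Module.End K V)) : Set (Module.End K V)) = A := by
  refine le_antisymm (fun f hf => ?_) Set.subset_centralizer_centralizer
  -- `A`-linear endomorphisms lie in the commutant of `A`, so `f` is linear over `Module.End A V`,
  -- as the density theorem requires.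
  let F : Module.End (Module.End A V) V :=
    { toFun := f
      map_add' := map_add f
      map_smul' := fun g v => by
        have hg : (g.restrictScalars K : Module.End K V) ∈
            Subalgebra.centralizer K (A : Set (Module.End K V)) := by
          rw [Subalgebra.mem_centralizer_iff]
          intro a ha
          ext w
          exact (g.map_smul (⟨a, ha⟩ : A) w).symm
        exact (LinearMap.congr_fun ((Subalgebra.mem_centralizer_iff K).mp hf _ hg) v).symm }
  classical
  let b := Module.finBasis K V
  -- Density gives agreement with an element of `A` on any finite set; a basis makes this equality.
  obtain ⟨a, ha⟩ := jacobson_density (R := A) F (Finset.univ.image b)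
  have : f = a := b.ext fun i => ha (b i) (Finset.mem_image_of_mem _ (Finset.mem_univ i))
  exact this ▸ a.2

/-- The double centralizer theorem for a subalgebra `A` of `End V` for which every endomorphism `p`
can be averaged to one which commutes with `A`, maps into every `A`-stable subspace containing the
range of `p`, and is the identity on every `A`-stable subspace on which `p` is the identity. -/
theorem Subalgebra.centralizer_centralizer_of_average {K V : Type*} [Field K]
    [AddCommGroup V] [Module K V] [FiniteDimensional K V] (A : Subalgebra K (Module.End K V))
    (E : Module.End K V → Module.End K V)
    (hE : ∀ p, ∀ a ∈ A, a * E p = E p * a)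
    (hrange : ∀ U : Submodule K V, (∀ a ∈ A, ∀ v ∈ U, a v ∈ U) →
      ∀ p, (∀ v, p v ∈ U) → ∀ v, E p v ∈ U)
    (hid : ∀ U : Submodule K V, (∀ a ∈ A, ∀ v ∈ U, a v ∈ U) →
      ∀ p, (∀ v ∈ U, p v = v) → ∀ v ∈ U, E p v = v) :
    Subalgebra.centralizer K
      (Subalgebra.centralizer K (A : Set (Module.End K V)) : Set (Module.End K V)) = A := by
  have : IsSemisimpleModule A V :=
    { toComplementedLattice := by
        refine ⟨fun U => ?_⟩
        have hU : ∀ a ∈ A, ∀ v ∈ U.restrictScalars K, a v ∈ U.restrictScalars K :=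
          fun a ha v hv => U.smul_mem (⟨a, ha⟩ : A) hv
        obtain ⟨q, hq⟩ := (U.restrictScalars K).exists_isCompl
        let p : Module.End K V := Submodule.projection _ _ hq
        have hp1 : ∀ v, p v ∈ U.restrictScalars K :=
          fun v => Submodule.projection_apply_mem hq v
        have hp2 : ∀ v ∈ U.restrictScalars K, p v = v :=
          fun v hv => Submodule.projection_apply_left hq ⟨v, hv⟩
        let P : V →ₗ[A] U :=
          { toFun := fun v => ⟨E p v, hrange _ hU p hp1 v⟩
            map_add' := fun v w => Subtype.ext (map_add (E p) v w)
            map_smul' := fun a v => Subtype.ext (LinearMap.congr_fun (hE p a a.2) v).symm }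
        exact ⟨LinearMap.ker P,
          LinearMap.isCompl_of_proj fun u => Subtype.ext (hid _ hU p hp2 u u.2)⟩ }
  exact A.centralizer_centralizer_of_isSemisimpleModule

/-- Polarization: the symmetrization of a multilinear map is a combination of its values on the
diagonal. -/
theorem MultilinearMap.sum_perm_eq_sum_diagonal {R ι M N : Type*} [CommRing R] [Fintype ι]
    [DecidableEq ι] [AddCommMonoid M] [Module R M] [AddCommMonoid N] [Module R N]
    (f : MultilinearMap R (fun _ : ι => M) N) (m : ι → M) :
    ∑ σ : Equiv.Perm ι, f (fun i => m (σ i)) =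
      ∑ t : Finset ι, (-1 : R) ^ t.card • f (fun _ => ∑ i ∈ tᶜ, m i) := by
  have h1 : ∀ t : Finset ι, f (fun _ => ∑ i ∈ tᶜ, m i) =
      ∑ g : ι → ι, if t ⊆ (Finset.univ.image g)ᶜ then f (fun i => m (g i)) else 0 := by
    intro t
    rw [f.map_sum_finset (fun _ => m) (fun _ => tᶜ), ← Finset.sum_filter]
    refine Finset.sum_congr ?_ fun _ _ => rfl
    ext g
    simp only [Fintype.mem_piFinset, Finset.mem_compl, Finset.mem_filter, Finset.mem_univ,
      true_and, Finset.subset_iff, Finset.mem_image, not_exists]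
    exact ⟨fun h i hi j hj => h j (hj ▸ hi), fun h j hj => h hj j rfl⟩
  simp only [h1, Finset.smul_sum]
  rw [Finset.sum_comm]
  -- Inclusion–exclusion: the signs over subsets of the complement of the image of `g` cancel unless
  -- that complement is empty, so only bijections survive.
  have h2 : ∀ g : ι → ι, (∑ t : Finset ι, (-1 : R) ^ t.card •
      if t ⊆ (Finset.univ.image g)ᶜ then f (fun i => m (g i)) else 0) =
      if Function.Bijective g then f (fun i => m (g i)) else 0 := by
    intro g
    simp only [smul_ite, smul_zero]
    rw [← Finset.sum_filter, ← Finset.sum_smul]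
    have : (Finset.univ.filter fun t : Finset ι => t ⊆ (Finset.univ.image g)ᶜ) =
        ((Finset.univ.image g)ᶜ).powerset := by
      ext; simp
    have hsum : ∀ x : Finset ι, ∑ t ∈ x.powerset, (-1 : R) ^ t.card = if x = ∅ then 1 else 0 := by
      intro x
      simpa using congrArg (Int.cast : ℤ → R) (Finset.sum_powerset_neg_one_pow_card (x := x))
    rw [this, hsum]
    have : (Finset.univ.image g)ᶜ = ∅ ↔ Function.Bijective g := by
      rw [Finset.compl_eq_empty_iff, ← Finite.surjective_iff_bijective]
      simp [Finset.eq_univ_iff_forall, Function.Surjective]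
    simp only [this]
    split_ifs <;> simp
  simp only [h2]
  rw [← Finset.sum_filter]
  refine Finset.sum_bij (fun σ _ => σ) (fun σ _ => by simp)
    (fun σ _ τ _ h => Equiv.coe_fn_injective h) (fun g hg => ?_) (fun _ _ => rfl)
  exact ⟨Equiv.ofBijective g (by simpa using hg), Finset.mem_univ _, rfl⟩

/-- On a finite tensor power of a finite free module, every endomorphism is a combination of pure
tensors of endomorphisms. -/
theorem PiTensorProduct.span_range_map_eq_top {K ι κ : Type*} [Field K] [Fintype ι] [Fintype κ] :
    Submodule.span K (Set.range fun A : ι → Module.End K (κ → K) => PiTensorProduct.map A) =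
      (⊤ : Submodule K (Module.End K (⨂[K] _ : ι, κ → K))) := by
  classical
  refine top_unique fun X _ => ?_
  let b := Basis.piTensorProduct (fun _ : ι => Pi.basisFun K κ)
  -- Matrix units of the tensor power are pure tensors of matrix units of the factors.
  have hX : X = ∑ k : ι → κ, ∑ j : ι → κ, b.repr (X (b k)) j • PiTensorProduct.map fun i =>
      (LinearMap.single K (fun _ : κ => K) (j i)) ∘ₗ LinearMap.proj (k i) := by
    refine b.ext fun l => ?_
    simp only [LinearMap.sum_apply, LinearMap.smul_apply]
    rw [Finset.sum_eq_single l]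
    · conv_lhs => rw [← b.sum_repr (X (b l))]
      refine Finset.sum_congr rfl fun j _ => ?_
      congr 1
      simp [b, PiTensorProduct.map_tprod]
    · intro k _ hk
      refine Finset.sum_eq_zero fun j _ => ?_
      obtain ⟨i, hi⟩ := Function.ne_iff.mp hk
      rw [show b l = _ from Basis.piTensorProduct_apply _ l, PiTensorProduct.map_tprod,
        MultilinearMap.map_coord_zero _ i, smul_zero]
      simp [hi]
    · simp
  rw [hX]
  exact Submodule.sum_mem _ fun k _ => Submodule.sum_mem _ fun j _ =>
    Submodule.smul_mem _ _ (Submodule.subset_span ⟨_, rfl⟩)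

/-- If a subspace contains `f (m + t e, …, m + t e)` for all `t` outside the zero set of a nonzero
polynomial, it contains `f (m, …, m)`. -/
theorem MultilinearMap.diagonal_mem_of_generic {K ι M N : Type*} [Field K] [Infinite K]
    [Fintype ι] [AddCommGroup M] [Module K M] [AddCommGroup N] [Module K N]
    (f : MultilinearMap K (fun _ : ι => M) N) (m e : M) (S : Submodule K N)
    (q : Polynomial K) (hq : q ≠ 0)
    (h : ∀ t : K, q.eval t ≠ 0 → f (fun _ => m + t • e) ∈ S) : f (fun _ => m) ∈ S := by
  classical
  by_contra hm
  obtain ⟨φ, hφ, hS⟩ := Submodule.exists_le_ker_of_notMem hm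
  -- A functional `φ` vanishing on `S` but not at the diagonal value turns `t ↦ f (m + t e, …)` into
  -- a polynomial. It vanishes wherever `q` does not, so `p * q = 0` over an infinite field, while
  -- `p` is nonzero at `0`.
  let p : Polynomial K := ∑ s : Finset ι,
    Polynomial.C (φ (f (s.piecewise (fun _ => e) (fun _ => m)))) * Polynomial.X ^ s.card
  have hp : ∀ t, p.eval t = φ (f (fun _ => m + t • e)) := by
    intro t
    have : (fun _ : ι => m + t • e) = (fun _ => t • e) + fun _ => m := by
      funext; simp [add_comm]
    rw [this, f.map_add_univ, _root_.map_sum, Polynomial.eval_finsetSum]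
    refine Finset.sum_congr rfl fun s _ => ?_
    have := f.map_piecewise_smul (fun _ => t) (s.piecewise (fun _ => e) (fun _ => m)) s
    have h2 : s.piecewise (fun i => t • s.piecewise (fun _ => e) (fun _ => m) i)
        (s.piecewise (fun _ => e) (fun _ => m)) =
        (s.piecewise (fun _ : ι => t • e) fun _ => m) := by
      funext i
      by_cases hi : i ∈ s <;> simp [hi]
    rw [h2] at this
    rw [this, Finset.prod_const, map_smul, smul_eq_mul, mul_comm]
    simp only [Polynomial.eval_mul, Polynomial.eval_C, Polynomial.eval_pow, Polynomial.eval_X]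
  have hpq : p * q = 0 := by
    refine Polynomial.funext fun t => ?_
    by_cases ht : q.eval t = 0
    · simp [ht]
    · have : φ (f (fun _ => m + t • e)) = 0 := hS (h t ht)
      simp [hp, this]
  have hp0 : p = 0 := (mul_eq_zero.mp hpq).resolve_right hq
  apply hφ
  have := hp 0
  simpa [hp0] using this.symm

/-! ### Position projections and the averaging operator. -/

namespace LeviSW

variable {n r : ℕ}

/-- The projection onto the summand of the tensor space whose factors in the positions `I` lie in
`V` and whose other factors lie in `ℂη`. -/
def posProj (n r : ℕ) (I : Finset (Fin r)) : TEnd n r :=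
  PiTensorProduct.map (I.piecewise (fun _ => projV n) fun _ => projEta n)

theorem Psi_mul_map (σ : Equiv.Perm (Fin r)) (A : Fin r → Module.End ℂ (ESpace n)) :
    Psi n r σ * PiTensorProduct.map A =
      PiTensorProduct.map (fun i => A (σ.symm i)) * Psi n r σ := by
  refine PiTensorProduct.ext (MultilinearMap.ext fun v => ?_)
  simp only [LinearMap.compMultilinearMap_apply, Module.End.mul_apply, PiTensorProduct.map_tprod,
    Psi_tprod]

theorem Psi_mul_map_mul_Psi_inv (σ : Equiv.Perm (Fin r)) (A : Fin r → Module.End ℂ (ESpace n)) :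
    Psi n r σ * PiTensorProduct.map A * Psi n r σ⁻¹ =
      PiTensorProduct.map fun i => A (σ.symm i) := by
  rw [Psi_mul_map, mul_assoc, ← map_mul, mul_inv_cancel, map_one, mul_one]

theorem Psi_mul_posProj (σ : Equiv.Perm (Fin r)) (I : Finset (Fin r)) :
    Psi n r σ * posProj n r I = posProj n r (I.map σ.toEmbedding) * Psi n r σ := by
  rw [posProj, Psi_mul_map, posProj]
  congr 2
  funext i
  simp only [Finset.piecewise, Finset.mem_map_equiv]

theorem posProj_mul_posProj (I J : Finset (Fin r)) :
    posProj n r I * posProj n r J = if I = J then posProj n r I else 0 := by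
  split_ifs with h
  · subst h
    rw [posProj, ← PiTensorProduct.map_mul]
    congr 1
    funext i
    by_cases hi : i ∈ I
    · simpa [hi] using! projV_projV n
    · simpa [hi] using! projEta_projEta n
  · have : ∃ i, ¬ (i ∈ I ↔ i ∈ J) := by
      by_contra! hc
      exact h (Finset.ext hc)
    obtain ⟨i, hi⟩ := this
    rw [posProj, posProj, ← PiTensorProduct.map_mul]
    refine (PiTensorProduct.mapMultilinear ℂ _ _).map_coord_zero i ?_
    by_cases hI : i ∈ I <;> by_cases hJ : i ∈ J
    · simp [hI, hJ] at hi
    · simpa [hI, hJ] using! projV_projEta n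
    · simpa [hI, hJ] using! projEta_projV n
    · simp [hI, hJ] at hi

/-- Multilinear expansion of a tensor product of sums. It yields both the resolution of the identity
by the `posProj n r I` and the block part of a pure tensor. -/
theorem sum_map_piecewise (A B : Fin r → Module.End ℂ (ESpace n)) :
    ∑ I : Finset (Fin r), PiTensorProduct.map (I.piecewise A B) = PiTensorProduct.map (A + B) :=
  ((PiTensorProduct.mapMultilinear ℂ (fun _ : Fin r => ESpace n)
    (fun _ => ESpace n)).map_add_univ A B).symm

theorem sum_posProj : ∑ I : Finset (Fin r), posProj n r I = 1 := by
  simp only [posProj]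
  rw [sum_map_piecewise]
  have : ((fun _ => projV n) + fun _ => projEta n : Fin r → Module.End ℂ (ESpace n)) =
      fun _ => 1 := by
    funext i
    exact sub_add_cancel _ _
  rw [this, PiTensorProduct.map_one]

/-- The block diagonal part of an endomorphism of the tensor space. -/
def blockPart (X : TEnd n r) : TEnd n r :=
  ∑ I : Finset (Fin r), posProj n r I * X * posProj n r I

theorem posProj_mul_blockPart (J : Finset (Fin r)) (X : TEnd n r) :
    posProj n r J * blockPart X = posProj n r J * X * posProj n r J := by
  rw [blockPart, Finset.mul_sum, Finset.sum_eq_single J]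
  · rw [← mul_assoc, ← mul_assoc, posProj_mul_posProj, if_pos rfl]
  · intro I _ hI
    rw [← mul_assoc, ← mul_assoc, posProj_mul_posProj, if_neg hI.symm, zero_mul, zero_mul]
  · simp

theorem blockPart_mul_posProj (J : Finset (Fin r)) (X : TEnd n r) :
    blockPart X * posProj n r J = posProj n r J * X * posProj n r J := by
  rw [blockPart, Finset.sum_mul, Finset.sum_eq_single J]
  · rw [mul_assoc, posProj_mul_posProj, if_pos rfl]
  · intro I _ hI
    rw [mul_assoc, posProj_mul_posProj, if_neg hI, mul_zero]
  · simp

/-- The average of the block diagonal part of `X` over the symmetric group. -/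
def average (X : TEnd n r) : TEnd n r :=
  (Fintype.card (Equiv.Perm (Fin r)) : ℂ)⁻¹ •
    ∑ σ : Equiv.Perm (Fin r), Psi n r σ * blockPart X * Psi n r σ⁻¹

theorem Psi_mul_average (τ : Equiv.Perm (Fin r)) (X : TEnd n r) :
    Psi n r τ * average X = average X * Psi n r τ := by
  rw [average, mul_smul_comm, smul_mul_assoc, Finset.mul_sum, Finset.sum_mul]
  congr 1
  refine Fintype.sum_equiv (Equiv.mulLeft τ) _ _ fun σ => ?_
  simp only [Equiv.coe_mulLeft, mul_inv_rev, map_mul, mul_assoc]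
  rw [← map_mul _ τ⁻¹, inv_mul_cancel, map_one, mul_one]

/-- Conjugation by `Ψ(σ)` permutes the position projections, so each conjugate of a block diagonal
operator still commutes with all of them. -/
theorem posProj_mul_average (J : Finset (Fin r)) (X : TEnd n r) :
    posProj n r J * average X = average X * posProj n r J := by
  rw [average, mul_smul_comm, smul_mul_assoc, Finset.mul_sum, Finset.sum_mul]
  congr 1
  refine Finset.sum_congr rfl fun σ _ => ?_
  have h1 : posProj n r J * Psi n r σ =
      Psi n r σ * posProj n r (J.map (σ⁻¹ : Equiv.Perm (Fin r)).toEmbedding) := by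
    rw [Psi_mul_posProj]
    congr 2
    ext i
    rw [Finset.mem_map_equiv, Finset.mem_map_equiv]
    change i ∈ J ↔ σ (σ.symm i) ∈ J
    rw [Equiv.apply_symm_apply]
  rw [← mul_assoc, ← mul_assoc, h1, mul_assoc _ (posProj n r _), posProj_mul_blockPart,
    ← blockPart_mul_posProj, mul_assoc (Psi n r σ * _), Psi_mul_posProj, mul_assoc, mul_assoc,
    mul_assoc]

theorem inv_card_smul_sum_const {M : Type*} [AddCommGroup M] [Module ℂ M] (x : M) :
    (Fintype.card (Equiv.Perm (Fin r)) : ℂ)⁻¹ • ∑ _σ : Equiv.Perm (Fin r), x = x := by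
  rw [Finset.sum_const, Finset.card_univ, ← Nat.cast_smul_eq_nsmul ℂ, smul_smul,
    inv_mul_cancel₀ (Nat.cast_ne_zero.mpr Fintype.card_ne_zero), one_smul]

theorem average_eq_self {X : TEnd n r} (hΨ : ∀ σ, Psi n r σ * X = X * Psi n r σ)
    (hP : ∀ I, posProj n r I * X = X * posProj n r I) : average X = X := by
  have hb : blockPart X = X := by
    rw [blockPart]
    simp only [hP, mul_assoc, posProj_mul_posProj, if_true]
    rw [← Finset.mul_sum, sum_posProj, mul_one]
  rw [average, hb]
  simp only [hΨ, mul_assoc, ← map_mul, mul_inv_cancel, map_one, mul_one]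
  exact inv_card_smul_sum_const X

/-- Taking the block part of a pure tensor acts factor by factor, and conjugation by `Ψ(σ)` permutes
the factors; replacing `σ` by its inverse gives the form used in polarization. -/
theorem average_map (A : Fin r → Module.End ℂ (ESpace n)) :
    average (PiTensorProduct.map A) = (Fintype.card (Equiv.Perm (Fin r)) : ℂ)⁻¹ •
      ∑ σ : Equiv.Perm (Fin r), PiTensorProduct.map fun i =>
        projV n * A (σ i) * projV n + projEta n * A (σ i) * projEta n := by
  have hb : blockPart (PiTensorProduct.map A) = PiTensorProduct.map fun i =>
      projV n * A i * projV n + projEta n * A i * projEta n := by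
    rw [blockPart]
    refine Eq.trans ?_ (sum_map_piecewise (fun i => projV n * A i * projV n)
      fun i => projEta n * A i * projEta n)
    refine Finset.sum_congr rfl fun I _ => ?_
    rw [posProj, ← PiTensorProduct.map_mul, ← PiTensorProduct.map_mul]
    congr 1
    funext i
    by_cases hi : i ∈ I <;> simp [hi]
  rw [average, hb]
  congr 1
  simp only [Psi_mul_map_mul_Psi_inv]
  exact Fintype.sum_equiv (Equiv.inv _) _ _ fun σ => rfl

/-! ### Generators of `D(n,r)` -/

theorem finDDHA_eq_adjoin : finDDHA n r = Algebra.adjoin ℂ (Set.range (genOp n r)) := by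
  have h : (Xi n r).comp (RingQuot.mkAlgHom ℂ (DDHARel r)) = FreeAlgebra.lift ℂ (genOp n r) := by
    ext x
    simp [Xi]
  rw [finDDHA, Algebra.adjoin_range_eq_range_freeAlgebra_lift, ← h, AlgHom.range_comp,
    (AlgHom.range_eq_top _).mpr (RingQuot.mkAlgHom_surjective ℂ _), Algebra.map_top]

theorem genOp_mem_finDDHA (g : DDHAGen r) : genOp n r g ∈ finDDHA n r := by
  rw [finDDHA_eq_adjoin]
  exact Algebra.subset_adjoin ⟨g, rfl⟩

theorem Psi_mem_finDDHA (σ : Equiv.Perm (Fin r)) : Psi n r σ ∈ finDDHA n r := by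
  -- Adjacent transpositions generate the permutations of `Fin (m + 1)`; the case `r = 0` is
  -- trivial.
  rcases r with _ | m
  · rw [Subsingleton.elim σ 1, map_one]
    exact one_mem _
  · have hσ : σ ∈ Submonoid.closure
        (Set.range fun i : Fin m => Equiv.swap i.castSucc i.succ) := by
      rw [Equiv.Perm.mclosure_swap_castSucc_succ]
      trivial
    induction hσ using Submonoid.closure_induction with
    | mem x hx =>
      obtain ⟨i, rfl⟩ := hx
      exact genOp_mem_finDDHA (n := n) (r := m + 1) (DDHAGen.s i)
    | one => rw [map_one]; exact one_mem _
    | mul x y _ _ hx hy => rw [map_mul]; exact mul_mem hx hy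

theorem levelProj_eq_posProj (l : Fin (r + 1)) :
    levelProj n r l = posProj n r (Finset.univ.filter fun i : Fin r => (i : ℕ) < l) := by
  rw [levelProj, posProj]
  congr 1
  funext i
  simp [Finset.piecewise]

/-- A permutation carries the initial segment of length `I.card` onto `I`, so the projection is
conjugate under `Ψ` to the operator of `x^{(l)}_1` with `l = I.card`. -/
theorem posProj_mem_finDDHA (I : Finset (Fin r)) : posProj n r I ∈ finDDHA n r := by
  let l : Fin (r + 1) := ⟨I.card, by simpa [Nat.lt_succ_iff] using I.card_le_univ⟩
  let J : Finset (Fin r) := Finset.univ.filter fun i : Fin r => (i : ℕ) < l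
  have hJ : posProj n r J ∈ finDDHA n r := by
    rw [← levelProj_eq_posProj]
    simpa [genOp, xOp] using genOp_mem_finDDHA (n := n) (DDHAGen.x l 1)
  have hcard : J.card = I.card := by
    have := Fin.card_filter_val_lt (n := r) (m := I.card)
    have h2 : I.card ≤ r := by simpa using I.card_le_univ
    simp [J, l, this, h2]
  let σ : Equiv.Perm (Fin r) := (Finset.equivOfCardEq hcard).extendSubtype
  have hσ : J.map σ.toEmbedding = I := by
    refine Finset.eq_of_subset_of_card_le (fun i hi => ?_) (by simp [hcard])
    obtain ⟨j, hj, rfl⟩ := Finset.mem_map.mp hi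
    exact (Finset.equivOfCardEq hcard).extendSubtype_mem j hj
  have h := Psi_mul_posProj (n := n) σ J
  rw [hσ] at h
  have h2 : posProj n r I = Psi n r σ * posProj n r J * Psi n r σ⁻¹ := by
    rw [h, mul_assoc, ← map_mul, mul_inv_cancel, map_one, mul_one]
  rw [h2]
  exact mul_mem (mul_mem (Psi_mem_finDDHA σ) hJ) (Psi_mem_finDDHA _)

theorem mem_endOver_finDDHA {X : TEnd n r} : X ∈ endOver (finDDHA n r) ↔
    (∀ σ, Psi n r σ * X = X * Psi n r σ) ∧ ∀ I, posProj n r I * X = X * posProj n r I := by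
  rw [endOver, Subalgebra.mem_centralizer_iff]
  refine ⟨fun h => ⟨fun σ => h _ (Psi_mem_finDDHA σ), fun I => h _ (posProj_mem_finDDHA I)⟩,
    fun ⟨hΨ, hP⟩ a ha => ?_⟩
  rw [SetLike.mem_coe, finDDHA_eq_adjoin] at ha
  suffices h : Algebra.adjoin ℂ (Set.range (genOp n r)) ≤ Subalgebra.centralizer ℂ {X} from
    ((Subalgebra.mem_centralizer_iff ℂ).mp (h ha) X rfl).symm
  refine Algebra.adjoin_le ?_
  rintro _ ⟨g, rfl⟩
  refine (Subalgebra.mem_centralizer_iff ℂ).mpr ?_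
  rintro _ rfl
  cases g with
  | s i => exact (hΨ _).symm
  | x l σ =>
    rw [genOp, xOp, levelProj_eq_posProj, ← mul_assoc, ← hΨ, mul_assoc, ← hP, mul_assoc]

theorem average_mem_endOver (X : TEnd n r) : average X ∈ endOver (finDDHA n r) :=
  mem_endOver_finDDHA.mpr ⟨fun σ => Psi_mul_average σ X, fun I => posProj_mul_average I X⟩

theorem endOver_endOver_finDDHA : endOver (endOver (finDDHA n r)) = finDDHA n r := by
  have : Module.Finite ℂ (TSpace n r) :=
    Module.Finite.of_basis (Basis.piTensorProduct fun _ => Pi.basisFun ℂ (Fin (n + 1)))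
  refine Subalgebra.centralizer_centralizer_of_average (finDDHA n r) average
    (fun p a ha => (Subalgebra.mem_centralizer_iff ℂ).mp (average_mem_endOver p) a ha)
    (fun U hU p hp v => ?_) (fun U hU p hp v hv => ?_)
  all_goals
    have hΨ : ∀ σ, ∀ u ∈ U, Psi n r σ u ∈ U := fun σ => hU _ (Psi_mem_finDDHA σ)
    have hP : ∀ I, ∀ u ∈ U, posProj n r I u ∈ U := fun I => hU _ (posProj_mem_finDDHA I)
    simp only [average, blockPart, LinearMap.smul_apply, LinearMap.sum_apply,
      Module.End.mul_apply]
  · exact U.smul_mem _ (U.sum_mem fun σ _ => hΨ _ _ (U.sum_mem fun I _ => hP _ _ (hp _)))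
  -- On a stable subspace where `p` is the identity, each block of `p` acts as `posProj n r I`;
  -- these sum to the identity, and so every term of the average fixes `v`.
  · have h1 : ∀ u ∈ U, ∑ I, posProj n r I (p (posProj n r I u)) = u := by
      intro u hu
      have : ∀ I, posProj n r I (p (posProj n r I u)) = posProj n r I u := by
        intro I
        rw [hp _ (hP I u hu), ← Module.End.mul_apply, posProj_mul_posProj, if_pos rfl]
      simp only [this]
      rw [← LinearMap.sum_apply, sum_posProj, Module.End.one_apply]
    have h2 : ∀ σ : Equiv.Perm (Fin r), Psi n r σ (∑ I, posProj n r I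
        (p (posProj n r I (Psi n r σ⁻¹ v)))) = v := by
      intro σ
      rw [h1 _ (hΨ _ v hv), ← Module.End.mul_apply, ← map_mul, mul_inv_cancel, map_one,
        Module.End.one_apply]
    simp only [h2]
    exact inv_card_smul_sum_const v

/-! ### The operators of the Levi subgroup -/

theorem diagBlock_mulVec_castSucc (A : Matrix (Fin n) (Fin n) ℂ) (c : ℂ) (v : ESpace n)
    (i : Fin n) : Matrix.toLin' (diagBlock n (A, c)) v i.castSucc =
      Matrix.toLin' A (fun j => v j.castSucc) i := by
  have h1 : ∀ j : Fin n, finSumFinEquiv.symm (Fin.castSucc j) = (Sum.inl j : Fin n ⊕ Fin 1) :=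
    fun j => finSumFinEquiv_symm_apply_castAdd j
  simp [Matrix.mulVec, dotProduct, diagBlock, h1]
  rfl

theorem diagBlock_mulVec_last (A : Matrix (Fin n) (Fin n) ℂ) (c : ℂ) (v : ESpace n) :
    Matrix.toLin' (diagBlock n (A, c)) v (Fin.last n) = c * v (Fin.last n) := by
  have h2 : finSumFinEquiv.symm (Fin.last n) = (Sum.inr 0 : Fin n ⊕ Fin 1) :=
    finSumFinEquiv_symm_apply_natAdd 0
  simp [Matrix.mulVec, dotProduct, diagBlock, h2]
  exact Or.inl rfl

theorem projEta_apply_castSucc (v : ESpace n) (i : Fin n) : projEta n v i.castSucc = 0 := by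
  simp [projEta]

theorem projEta_apply_last (v : ESpace n) : projEta n v (Fin.last n) = v (Fin.last n) := by
  simp [projEta]

theorem projV_apply_castSucc (v : ESpace n) (i : Fin n) :
    projV n v i.castSucc = v i.castSucc := by
  simp [projV, projEta_apply_castSucc]

theorem projV_apply_last (v : ESpace n) : projV n v (Fin.last n) = 0 := by
  simp [projV, projEta_apply_last]

theorem commute_diagBlock_projEta (p : Matrix (Fin n) (Fin n) ℂ × ℂ) :
    Commute (Matrix.toLin' (diagBlock n p)) (projEta n) := by
  refine LinearMap.ext fun v => funext fun i => ?_
  rw [Module.End.mul_apply, Module.End.mul_apply]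
  induction i using Fin.lastCases with
  | last => rw [diagBlock_mulVec_last, projEta_apply_last, projEta_apply_last,
      diagBlock_mulVec_last]
  | cast i =>
    rw [diagBlock_mulVec_castSucc, projEta_apply_castSucc]
    simp only [projEta_apply_castSucc]
    exact congrFun (map_zero (Matrix.toLin' p.1)) i

/-- The block diagonal part of an endomorphism of `V ⊕ ℂη` is given by a block diagonal matrix. -/
theorem exists_diagBlock_eq (A : Module.End ℂ (ESpace n)) : ∃ p,
    Matrix.toLin' (diagBlock n p) = projV n * A * projV n + projEta n * A * projEta n := by
  let M := LinearMap.toMatrix' A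
  have hA : A = Matrix.toLin' M := (Matrix.toLin'_toMatrix' A).symm
  refine ⟨(M.submatrix Fin.castSucc Fin.castSucc, M (Fin.last n) (Fin.last n)), ?_⟩
  refine LinearMap.ext fun v => funext fun i => ?_
  rw [hA]
  simp only [LinearMap.add_apply, Module.End.mul_apply, Pi.add_apply]
  induction i using Fin.lastCases with
  | last =>
    rw [diagBlock_mulVec_last, projV_apply_last, projEta_apply_last]
    simp [Matrix.mulVec, dotProduct, Fin.sum_univ_castSucc, projEta_apply_castSucc,
      projEta_apply_last]
  | cast i =>
    rw [diagBlock_mulVec_castSucc, projV_apply_castSucc, projEta_apply_castSucc]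
    simp [Matrix.mulVec, dotProduct, Fin.sum_univ_castSucc, projV_apply_castSucc,
      projV_apply_last]

/-- Shifting by scalars stays among block diagonal maps, so the line through `diag(A, c)` in
direction `1` can be used to reach invertible ones. -/
theorem diagBlock_add_smul_one (A : Matrix (Fin n) (Fin n) ℂ) (c t : ℂ) :
    Matrix.toLin' (diagBlock n (A + t • 1, c + t)) = Matrix.toLin' (diagBlock n (A, c)) + t • 1 := by
  refine LinearMap.ext fun v => funext fun i => ?_
  induction i using Fin.lastCases with
  | last => simp [-Matrix.toLin'_apply, diagBlock_mulVec_last, add_mul]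
  | cast i =>
    simp only [LinearMap.add_apply, Pi.add_apply, diagBlock_mulVec_castSucc, map_add, map_smul,
      Matrix.toLin'_one, LinearMap.smul_apply, Pi.smul_apply, LinearMap.id_apply,
      Module.End.one_apply]

theorem map_diagBlock_mem_CPhiLevi_of_isUnit {A : Matrix (Fin n) (Fin n) ℂ} {c : ℂ}
    (hA : IsUnit A) (hc : c ≠ 0) :
    PiTensorProduct.map (fun _ => Matrix.toLin' (diagBlock n (A, c))) ∈ CPhiLevi n r := by
  obtain ⟨g, rfl⟩ := hA
  exact Algebra.subset_adjoin ⟨(g, Units.mk0 c hc), rfl⟩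

theorem map_diagBlock_mem_CPhiLevi (p : Matrix (Fin n) (Fin n) ℂ × ℂ) :
    PiTensorProduct.map (fun _ => Matrix.toLin' (diagBlock n p)) ∈ CPhiLevi n r := by
  obtain ⟨A, c⟩ := p
  refine MultilinearMap.diagonal_mem_of_generic (M := Module.End ℂ (ESpace n)) (N := TEnd n r)
    (PiTensorProduct.mapMultilinear ℂ (fun _ : Fin r => ESpace n) (fun _ => ESpace n))
    (Matrix.toLin' (diagBlock n (A, c))) 1
    -- At `t` this polynomial takes the value `det (A + t) * (c + t)`, which is nonzero exactly when
    -- `diag(A + t, c + t)` is invertible.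
    (Subalgebra.toSubmodule (CPhiLevi n r)) ((-A).charpoly * (Polynomial.X + Polynomial.C c))
    (mul_ne_zero (Matrix.charpoly_monic _).ne_zero (Polynomial.X_add_C_ne_zero c))
    fun t ht => ?_
  rw [Polynomial.eval_mul, Matrix.eval_charpoly] at ht
  have h1 : IsUnit (A + t • 1) := by
    rw [Matrix.isUnit_iff_isUnit_det, isUnit_iff_ne_zero]
    convert left_ne_zero_of_mul ht using 2
    rw [sub_neg_eq_add, add_comm, Matrix.smul_one_eq_diagonal]
    rfl
  have h2 : c + t ≠ 0 := by
    simpa [add_comm] using right_ne_zero_of_mul ht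
  have h := map_diagBlock_mem_CPhiLevi_of_isUnit (r := r) h1 h2
  rw [diagBlock_add_smul_one] at h
  exact h

theorem diagBlock_add (p q : Matrix (Fin n) (Fin n) ℂ × ℂ) :
    Matrix.toLin' (diagBlock n (p + q)) =
      Matrix.toLin' (diagBlock n p) + Matrix.toLin' (diagBlock n q) := by
  refine LinearMap.ext fun v => funext fun i => ?_
  induction i using Fin.lastCases with
  | last => exact (diagBlock_mulVec_last _ _ v).trans (by
      rw [LinearMap.add_apply, Pi.add_apply, diagBlock_mulVec_last, diagBlock_mulVec_last]
      exact add_mul _ _ _)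
  | cast i => exact (diagBlock_mulVec_castSucc _ _ v i).trans (by
      rw [LinearMap.add_apply, Pi.add_apply, diagBlock_mulVec_castSucc,
        diagBlock_mulVec_castSucc, map_add]
      rfl)

/-- Polarization evaluates at partial sums of block diagonal maps; these must be block diagonal
again. -/
theorem exists_diagBlock_eq_sum {ι : Type*} (s : Finset ι)
    (p : ι → Matrix (Fin n) (Fin n) ℂ × ℂ) : ∃ q,
      Matrix.toLin' (diagBlock n q) = ∑ i ∈ s, Matrix.toLin' (diagBlock n (p i)) := by
  let D : Matrix (Fin n) (Fin n) ℂ × ℂ →+ Module.End ℂ (ESpace n) :=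
    AddMonoidHom.mk' (fun p => Matrix.toLin' (diagBlock n p)) diagBlock_add
  exact ⟨∑ i ∈ s, p i, map_sum D p s⟩

/-- Linearity reduces to pure tensors, whose average is a symmetrized product of block diagonal
maps; polarization turns it into diagonal powers. -/
theorem average_mem_CPhiLevi (X : TEnd n r) : average X ∈ CPhiLevi n r := by
  let E : TEnd n r →ₗ[ℂ] TEnd n r :=
    { toFun := average
      map_add' := fun X Y => by
        simp only [average, blockPart, mul_add, add_mul, Finset.sum_add_distrib, smul_add]
      map_smul' := fun c X => by
        simp only [average, blockPart, mul_smul_comm, smul_mul_assoc, ← Finset.smul_sum,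
          RingHom.id_apply, smul_comm c] }
  suffices h : (⊤ : Submodule ℂ (TEnd n r)) ≤
      (Subalgebra.toSubmodule (CPhiLevi n r)).comap E from h (Submodule.mem_top (x := X))
  rw [← PiTensorProduct.span_range_map_eq_top, Submodule.span_le]
  rintro _ ⟨A, rfl⟩
  change average _ ∈ CPhiLevi n r
  rw [average_map]
  refine Subalgebra.smul_mem _ ?_ _
  choose p hp using fun i => exists_diagBlock_eq (A i)
  simp only [← hp]
  have h := MultilinearMap.sum_perm_eq_sum_diagonal (R := ℂ) (M := Module.End ℂ (ESpace n))
    (N := TEnd n r) (PiTensorProduct.mapMultilinear ℂ (fun _ : Fin r => ESpace n)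
    (fun _ => ESpace n)) fun i => Matrix.toLin' (diagBlock n (p i))
  simp only [PiTensorProduct.mapMultilinear_apply] at h
  rw [h]
  refine Subalgebra.sum_mem _ fun t _ => Subalgebra.smul_mem _ ?_ _
  obtain ⟨q, hq⟩ := exists_diagBlock_eq_sum tᶜ p
  rw [← hq]
  exact map_diagBlock_mem_CPhiLevi q

/-! ### The two commutants and the equality of the two Levi algebras. -/

theorem PhiLevi_mem_endOver (g : GL (Fin n) ℂ × ℂˣ) :
    PhiLevi n r g ∈ endOver (finDDHA n r) := by
  have hg : PhiLevi n r g = PiTensorProduct.map fun _ =>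
    Matrix.toLin' (diagBlock n (g.1, g.2)) := rfl
  have hη := commute_diagBlock_projEta (n := n) (g.1, g.2)
  have hV : Commute (Matrix.toLin' (diagBlock n (g.1, g.2))) (projV n) :=
    (Commute.one_right _).sub_right hη
  rw [mem_endOver_finDDHA, hg]
  refine ⟨fun σ => Psi_mul_map σ _, fun I => ?_⟩
  rw [posProj, ← PiTensorProduct.map_mul, ← PiTensorProduct.map_mul]
  congr 1
  funext i
  by_cases hi : i ∈ I
  · simpa only [Finset.piecewise, if_pos hi] using hV.eq.symm
  · simpa only [Finset.piecewise, if_neg hi] using hη.eq.symm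

theorem endOver_finDDHA : endOver (finDDHA n r) = CPhiLevi n r := by
  refine le_antisymm (fun X hX => ?_) (Algebra.adjoin_le ?_)
  · rw [mem_endOver_finDDHA] at hX
    rw [← average_eq_self hX.1 hX.2]
    exact average_mem_CPhiLevi X
  · rintro _ ⟨g, rfl⟩
    exact PhiLevi_mem_endOver g

/-- The group algebra is spanned by group elements, so its image is contained in the generated
subalgebra; being itself a subalgebra containing the generators, it is all of it. -/
theorem leviSchur_eq_CPhiLevi : leviSchur n r = CPhiLevi n r := by
  refine le_antisymm ?_ (Algebra.adjoin_le ?_)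
  · rintro _ ⟨x, rfl⟩
    change (PhiLevi n r).asAlgebraHom x ∈ _
    rw [Representation.asAlgebraHom_def, MonoidAlgebra.lift_apply]
    exact Subalgebra.sum_mem _ fun g _ =>
      Subalgebra.smul_mem _ (Algebra.subset_adjoin (Set.mem_range_self g)) _
  · rintro _ ⟨g, rfl⟩
    change _ ∈ (PhiLevi n r).asAlgebraHom.range
    exact ⟨MonoidAlgebra.of ℂ _ g, (PhiLevi n r).asAlgebraHom_of g⟩

end LeviSW

end

theorem theorem4p4 (n r : ℕ) :
    LeviSW.endOver (LeviSW.finDDHA n r) = LeviSW.CPhiLevi n r ∧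
    LeviSW.endOver (LeviSW.leviSchur n r) = LeviSW.finDDHA n r ∧
    LeviSW.endOver (LeviSW.finDDHA n r) = LeviSW.leviSchur n r := by
  rw [LeviSW.leviSchur_eq_CPhiLevi, ← LeviSW.endOver_finDDHA]
  exact ⟨rfl, LeviSW.endOver_endOver_finDDHA, rfl⟩
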